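/- Throughout, a \emph{normal integral domain} is a Noetherian integral domain that is integrally closed in its field of fractions. For a commutative ring $R$ and an $R$-module $M$ put $M^{*}=\operatorname{Hom}_R(M,R)$ and $M^{**}=(M^{*})^{*}$; a finitely generated $R$-module $M$ is \emph{reflexive} if the natural map $M\to M^{**}$, $m\mapsto(g\mapsto g(m))$, is an isomorphism. For a normal integral domain $A$, the \emph{divisor class group} $\operatorname{Cl}(A)$ is the group of isomorphism classes $[\mathfrak a]$ of finitely generated reflexive $A$-modules $\mathfrak a$ of rank one, with multiplication $[\mathfrak a]\cdot[\mathfrak b]=[(\mathfrak a\otimes_A\mathfrak b)^{**}]$, identity $[A]$ and inverse $[\mathfrak a]^{-1}=[\mathfrak a^{*}]$. \textbf{Theorem.} Let $\varphi\colon A\to B$ be a ring homomorphism of normal integral domains such that, for every prime ideal $P$ of $B$ of height at most one, the localization $A_{\varphi^{-1}(P)}$ is a unique factorization domain. Then for every finitely generated reflexive $A$-module $\mathfrak a$ of rank one, the $B$-module $(\mathfrak a\otimes_A B)^{**}$ (double dual over $B$) is finitely generated, reflexive and of rank one, and there is a unique group homomorphism $\operatorname{Cl}(\varphi)\colon\operatorname{Cl}(A)\to\operatorname{Cl}(B)$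 with $$\operatorname{Cl}(\varphi)([\mathfrak a])=[(\mathfrak a\otimes_A B)^{**}]$$ for all such $\mathfrak a$. -/

import Mathlib

open TensorProduct

universe u v w

namespace DivisorClass

/-- The double dual `Hom_R(Hom_R(M, R), R)` of an `R`-module `M`. -/
abbrev DoubleDual (R : Type*) (M : Type*) [CommRing R] [AddCommGroup M] [Module R M] : Type _ :=
  Module.Dual R (Module.Dual R M)

/-- A finitely generated reflexive `R`-module of rank one (for `R` a domain, `Module.finrank R M`
is the dimension of `Frac(R) ⊗ M` over `Frac(R)`, see `finrank_fractionRing_tensor` below). -/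
structure IsReflexiveRankOne (R : Type*) (M : Type*) [CommRing R] [AddCommGroup M] [Module R M] :
    Prop where
  finite : Module.Finite R M
  reflexive : Module.IsReflexive R M
  rank_one : Module.finrank R M = 1

/-- The set of primes `p` of `R` such that `R_p` is a unique factorization domain. -/
def UFDLocus (R : Type*) [CommRing R] [IsDomain R] : Set (PrimeSpectrum R) :=
  {p | UniqueFactorizationMonoid (Localization.AtPrime p.asIdeal)}

section Rank

variable {R : Type*} [CommRing R] [IsDomain R]
variable {M N : Type*} [AddCommGroup M] [Module R M] [AddCommGroup N] [Module R N]

theorem finrank_fractionRing_tensor :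
    Module.finrank (FractionRing R) (FractionRing R ⊗[R] M) = Module.finrank R M :=
  (TensorProduct.isBaseChange R M (FractionRing R)).finrank_eq

theorem finrank_tensor :
    Module.finrank R (M ⊗[R] N) = Module.finrank R M * Module.finrank R N := by
  rw [← finrank_fractionRing_tensor, ← finrank_fractionRing_tensor (M := M),
    ← finrank_fractionRing_tensor (M := N),
    (AlgebraTensorModule.distribBaseChange R (FractionRing R) M N).finrank_eq,
    Module.finrank_tensorProduct]

theorem isReflexiveRankOne_self : IsReflexiveRankOne R R :=
  ⟨inferInstance, inferInstance, Module.finrank_self R⟩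

theorem isReflexiveRankOne_of_equiv {R : Type*} [CommRing R] {M N : Type*} [AddCommGroup M]
    [Module R M] [AddCommGroup N] [Module R N] (h : IsReflexiveRankOne R M) (e : M ≃ₗ[R] N) :
    IsReflexiveRankOne R N :=
  have := h.finite
  have := h.reflexive
  ⟨Module.Finite.equiv e, Module.equiv e, e.finrank_eq ▸ h.rank_one⟩

variable [IsNoetherianRing R]

theorem finite_dual {R : Type*} [CommRing R] [IsNoetherianRing R] {M : Type*} [AddCommGroup M]
    [Module R M] [Module.Finite R M] : Module.Finite R (Module.Dual R M) := by
  obtain ⟨n, f, hf⟩ := Module.Finite.exists_fin' R M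
  exact Module.Finite.of_injective f.dualMap (LinearMap.dualMap_injective_of_surjective hf)

theorem finrank_dual [Module.Finite R M] :
    Module.finrank R (Module.Dual R M) = Module.finrank R M := by
  have := Module.finitePresentation_of_finite R M
  let S := nonZeroDivisors R
  let K := FractionRing R
  let f : M →ₗ[R] K ⊗[R] M := TensorProduct.mk R K M 1
  have hf : IsLocalizedModule S f :=
    (isLocalizedModule_iff_isBaseChange S K f).2 (TensorProduct.isBaseChange R M K)
  have h := IsLocalizedModule.finrank_eq (p := S)
    (f := IsLocalizedModule.mapExtendScalars S f (Algebra.linearMap R K) K) le_rfl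
  rw [← finrank_fractionRing_tensor (M := M)]
  rw [← Subspace.dual_finrank_eq, IsFractionRing.finrank_right_eq R (FractionRing R)]
  exact h.symm

/-- The dual of a finitely generated module over a Noetherian domain is reflexive. -/
theorem isReflexive_dual [Module.Finite R M] : Module.IsReflexive R (Module.Dual R M) := by
  have := finite_dual (R := R) (M := M)
  have := finite_dual (R := R) (M := Module.Dual R M)
  have := finite_dual (R := R) (M := DoubleDual R M)
  let D := Module.Dual R M
  let e : D →ₗ[R] DoubleDual R D := Module.Dual.eval R D
  let s : DoubleDual R D →ₗ[R] D := (Module.Dual.eval R M).dualMap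
  have hse : ∀ x, s (e x) = x := fun x => by ext m; rfl
  have hs : Function.Surjective s := fun x => ⟨e x, hse x⟩
  have hker : Module.finrank R (LinearMap.ker s) = 0 := by
    have h1 := Submodule.finrank_quotient_add_finrank (LinearMap.ker s)
    rw [(s.quotKerEquivOfSurjective hs).finrank_eq] at h1
    have h2 : Module.finrank R (DoubleDual R D) = Module.finrank R D := by
      rw [finrank_dual, finrank_dual]
    omega
  have hinj : Function.Injective s := by
    rw [← LinearMap.ker_eq_bot, ← Submodule.subsingleton_iff_eq_bot]
    exact Module.finrank_zero_iff.1 hker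
  refine ⟨⟨fun x y h => ?_, fun x => ⟨s x, hinj (hse _)⟩⟩⟩
  rw [← hse x, ← hse y]
  exact congrArg s h

theorem isReflexiveRankOne_dual [Module.Finite R M] (h : Module.finrank R M = 1) :
    IsReflexiveRankOne R (Module.Dual R M) :=
  ⟨finite_dual, isReflexive_dual, finrank_dual.trans h⟩

theorem isReflexiveRankOne_doubleDual [Module.Finite R M] (h : Module.finrank R M = 1) :
    IsReflexiveRankOne R (DoubleDual R M) :=
  have h' := isReflexiveRankOne_dual h
  have := h'.finite
  isReflexiveRankOne_dual h'.rank_one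

/-- The dual of `M ⊗ N` does not change when `M` is replaced by its double dual. -/
noncomputable def dualDoubleDualTensor [Module.Finite R M] :
    Module.Dual R (DoubleDual R M ⊗[R] N) ≃ₗ[R] Module.Dual R (M ⊗[R] N) :=
  have := isReflexive_dual (R := R) (M := M)
  (TensorProduct.comm R N (DoubleDual R M)).dualMap ≪≫ₗ
    (TensorProduct.lift.equiv (.id R) N (DoubleDual R M) R).symm ≪≫ₗ
    (LinearEquiv.congrRight (Module.evalEquiv R (Module.Dual R M)).symm) ≪≫ₗ
    (TensorProduct.lift.equiv (.id R) N M R) ≪≫ₗ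
    (TensorProduct.comm R M N).dualMap

end Rank

/-- Over a normal domain, a torsion-free module of rank one has only scalar endomorphisms. -/
theorem algebraMap_end_bijective {R : Type*} [CommRing R] [IsDomain R] [IsIntegrallyClosed R]
    {M : Type*} [AddCommGroup M] [Module R M] [Module.Finite R M] [Module.IsTorsionFree R M]
    (h : Module.finrank R M = 1) :
    Function.Bijective (Algebra.linearMap R (Module.End R M)) := by
  let K := FractionRing R
  let ι : M →ₗ[R] K ⊗[R] M := TensorProduct.mk R K M 1
  have hloc : IsLocalizedModule (nonZeroDivisors R) ι :=
    (isLocalizedModule_iff_isBaseChange (nonZeroDivisors R) K ι).2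
      (TensorProduct.isBaseChange R M K)
  have hι : Function.Injective ι := by
    rw [injective_iff_map_eq_zero]
    intro m hm
    obtain ⟨c, hc⟩ := (IsLocalizedModule.eq_zero_iff (nonZeroDivisors R) ι).1 hm
    exact (smul_eq_zero_iff_right (nonZeroDivisors.coe_ne_zero c)).1 hc
  have hK : Module.finrank K (K ⊗[R] M) = 1 := finrank_fractionRing_tensor.trans h
  have : Nontrivial M := Module.nontrivial_of_finrank_pos (R := R) (by omega)
  have : Nontrivial (K ⊗[R] M) := Module.nontrivial_of_finrank_pos (R := K) (by omega)
  constructor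
  · exact FaithfulSMul.algebraMap_injective R (Module.End R M)
  · intro f
    obtain ⟨c, hc, -⟩ :=
      LinearMap.existsUnique_eq_smul_id_of_finrank_eq_one hK (f.baseChange K)
    have h1 : IsIntegral R (Module.End.baseChangeHom R K M f) :=
      (Algebra.IsIntegral.isIntegral (R := R) f).map (Module.End.baseChangeHom R K M)
    have h2 : Module.End.baseChangeHom R K M f = algebraMap K (Module.End K (K ⊗[R] M)) c := by
      exact hc
    rw [h2, isIntegral_algebraMap_iff (FaithfulSMul.algebraMap_injective _ _)] at h1
    obtain ⟨r, hr⟩ := IsIntegrallyClosed.isIntegral_iff.1 h1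
    refine ⟨r, LinearMap.ext fun m => hι ?_⟩
    have h3 := LinearMap.congr_fun hc (ι m)
    simp only [ι, TensorProduct.mk_apply, LinearMap.baseChange_tmul, LinearMap.smul_apply,
      LinearMap.id_apply] at h3
    simp only [ι, TensorProduct.mk_apply, h3, ← hr, Algebra.linearMap_apply,
      Module.algebraMap_end_apply, algebraMap_smul, TensorProduct.tmul_smul]

/-- A reflexive module of rank one over `R`, living in the universe of `R`. -/
structure RankOneReflexive (R : Type u) [CommRing R] where
  carrier : Type u
  [addCommGroup : AddCommGroup carrier]
  [module : Module R carrier]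
  isReflexiveRankOne : IsReflexiveRankOne R carrier

attribute [instance] RankOneReflexive.addCommGroup RankOneReflexive.module

/-- The relation "isomorphic as `R`-modules". -/
instance RankOneReflexive.setoid (R : Type u) [CommRing R] : Setoid (RankOneReflexive R) where
  r M N := Nonempty (M.carrier ≃ₗ[R] N.carrier)
  iseqv := ⟨fun _ => ⟨.refl _ _⟩, fun ⟨e⟩ => ⟨e.symm⟩, fun ⟨e⟩ ⟨f⟩ => ⟨e ≪≫ₗ f⟩⟩

/-- The divisor class group: isomorphism classes of reflexive `R`-modules of rank one. -/
def Cl (R : Type u) [CommRing R] : Type (u + 1) :=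
  Quotient (RankOneReflexive.setoid R)

namespace Cl

/-- The class `[M]` of a reflexive `R`-module of rank one, in an arbitrary universe: as `M` is
finitely generated, it is isomorphic to a module in the universe of `R`. -/
noncomputable def mk (R : Type u) [CommRing R] (M : Type w) [AddCommGroup M] [Module R M]
    (h : IsReflexiveRankOne R M) : Cl R :=
  have := h.finite
  have : Small.{u} M := Module.Finite.small.{u} R M
  Quotient.mk _
    { carrier := Shrink.{u} M
      isReflexiveRankOne :=
        isReflexiveRankOne_of_equiv h (Shrink.linearEquiv R M).symm }

section

variable {R : Type u} [CommRing R]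

theorem mk_eq_mk_iff {M : Type v} [AddCommGroup M] [Module R M] {hM : IsReflexiveRankOne R M}
    {N : Type w} [AddCommGroup N] [Module R N] {hN : IsReflexiveRankOne R N} :
    mk R M hM = mk R N hN ↔ Nonempty (M ≃ₗ[R] N) := by
  have := hM.finite
  have := hN.finite
  have : Small.{u} M := Module.Finite.small.{u} R M
  have : Small.{u} N := Module.Finite.small.{u} R N
  let eM := Shrink.linearEquiv.{u} R M
  let eN := Shrink.linearEquiv.{u} R N
  refine Quotient.eq.trans ⟨fun ⟨e⟩ => ⟨eM.symm ≪≫ₗ e ≪≫ₗ eN⟩, fun ⟨e⟩ => ⟨eM ≪≫ₗ e ≪≫ₗ eN.symm⟩⟩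

theorem mk_carrier (M : RankOneReflexive R) :
    mk R M.carrier M.isReflexiveRankOne = Quotient.mk _ M := by
  have := M.isReflexiveRankOne.finite
  have : Small.{u} M.carrier := Module.Finite.small.{u} R M.carrier
  exact Quotient.sound ⟨Shrink.linearEquiv R M.carrier⟩

theorem exists_eq_mk (x : Cl R) :
    ∃ M : RankOneReflexive R, x = mk R M.carrier M.isReflexiveRankOne := by
  induction x using Quotient.inductionOn with
  | h M => exact ⟨M, (mk_carrier M).symm⟩

end

section Group

variable {R : Type u} [CommRing R] [IsDomain R]

/-- The identity is `[R]`. -/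
instance : One (Cl R) where
  one := Quotient.mk _ ⟨R, isReflexiveRankOne_self⟩

theorem mk_self : mk R R isReflexiveRankOne_self = 1 :=
  mk_carrier ⟨R, isReflexiveRankOne_self⟩

variable [IsNoetherianRing R]

theorem isReflexiveRankOne_mul {M : Type v} [AddCommGroup M] [Module R M]
    (hM : IsReflexiveRankOne R M) {N : Type w} [AddCommGroup N] [Module R N]
    (hN : IsReflexiveRankOne R N) : IsReflexiveRankOne R (DoubleDual R (M ⊗[R] N)) :=
  have := hM.finite
  have := hN.finite
  isReflexiveRankOne_doubleDual (by rw [finrank_tensor, hM.rank_one, hN.rank_one])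

theorem isReflexiveRankOne_inv {M : Type v} [AddCommGroup M] [Module R M]
    (hM : IsReflexiveRankOne R M) : IsReflexiveRankOne R (Module.Dual R M) :=
  have := hM.finite
  isReflexiveRankOne_dual hM.rank_one

/-- `[M] * [N] = [(M ⊗ N)**]`. -/
noncomputable instance : Mul (Cl R) where
  mul := Quotient.map₂
    (fun M N => ⟨DoubleDual R (M.carrier ⊗[R] N.carrier),
      isReflexiveRankOne_mul M.isReflexiveRankOne N.isReflexiveRankOne⟩)
    (fun _ _ ⟨e⟩ _ _ ⟨f⟩ => ⟨(TensorProduct.congr e f).dualMap.dualMap⟩)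

/-- `[M]⁻¹ = [M*]`. -/
noncomputable instance : Inv (Cl R) where
  inv := Quotient.map
    (fun M => ⟨Module.Dual R M.carrier, isReflexiveRankOne_inv M.isReflexiveRankOne⟩)
    (fun _ _ ⟨e⟩ => ⟨e.symm.dualMap⟩)

theorem mk_mul_mk {M : Type v} [AddCommGroup M] [Module R M] (hM : IsReflexiveRankOne R M)
    {N : Type w} [AddCommGroup N] [Module R N] (hN : IsReflexiveRankOne R N) :
    mk R M hM * mk R N hN =
      mk R (DoubleDual R (M ⊗[R] N)) (isReflexiveRankOne_mul hM hN) := by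
  have := hM.finite
  have := hN.finite
  have : Small.{u} M := Module.Finite.small.{u} R M
  have : Small.{u} N := Module.Finite.small.{u} R N
  let eM := Shrink.linearEquiv.{u} R M
  let eN := Shrink.linearEquiv.{u} R N
  refine (mk_carrier _).symm.trans (mk_eq_mk_iff.2 ?_)
  exact ⟨(TensorProduct.congr eM eN).dualMap.dualMap⟩

theorem inv_mk {M : Type v} [AddCommGroup M] [Module R M] (hM : IsReflexiveRankOne R M) :
    (mk R M hM)⁻¹ = mk R (Module.Dual R M) (isReflexiveRankOne_inv hM) := by
  have := hM.finite
  have : Small.{u} M := Module.Finite.small.{u} R M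
  let eM := Shrink.linearEquiv.{u} R M
  exact (mk_carrier _).symm.trans (mk_eq_mk_iff.2 ⟨eM.symm.dualMap⟩)

/-- The group law on the divisor class group of a Noetherian normal domain. -/
noncomputable instance [IsIntegrallyClosed R] : CommGroup (Cl R) where
  mul_assoc x y z := by
    obtain ⟨L, rfl⟩ := exists_eq_mk x
    obtain ⟨M, rfl⟩ := exists_eq_mk y
    obtain ⟨N, rfl⟩ := exists_eq_mk z
    have := L.isReflexiveRankOne.finite
    have := M.isReflexiveRankOne.finite
    have := N.isReflexiveRankOne.finite
    simp only [mk_mul_mk]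
    refine mk_eq_mk_iff.2 ⟨LinearEquiv.dualMap ?_⟩
    exact (TensorProduct.comm R (DoubleDual R (M.carrier ⊗[R] N.carrier)) L.carrier).dualMap ≪≫ₗ
      dualDoubleDualTensor ≪≫ₗ
      (TensorProduct.assoc R L.carrier M.carrier N.carrier ≪≫ₗ
        TensorProduct.comm R L.carrier (M.carrier ⊗[R] N.carrier)).dualMap ≪≫ₗ
      dualDoubleDualTensor.symm
  one_mul x := by
    obtain ⟨M, rfl⟩ := exists_eq_mk x
    have := M.isReflexiveRankOne.reflexive
    rw [← mk_self, mk_mul_mk]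
    exact mk_eq_mk_iff.2
      ⟨(TensorProduct.lid R M.carrier).dualMap.dualMap ≪≫ₗ (Module.evalEquiv R M.carrier).symm⟩
  mul_one x := by
    obtain ⟨M, rfl⟩ := exists_eq_mk x
    have := M.isReflexiveRankOne.reflexive
    rw [← mk_self, mk_mul_mk]
    exact mk_eq_mk_iff.2
      ⟨(TensorProduct.rid R M.carrier).dualMap.dualMap ≪≫ₗ (Module.evalEquiv R M.carrier).symm⟩
  mul_comm x y := by
    obtain ⟨M, rfl⟩ := exists_eq_mk x
    obtain ⟨N, rfl⟩ := exists_eq_mk y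
    rw [mk_mul_mk, mk_mul_mk]
    exact mk_eq_mk_iff.2 ⟨(TensorProduct.comm R M.carrier N.carrier).dualMap.dualMap⟩
  inv_mul_cancel x := by
    obtain ⟨M, rfl⟩ := exists_eq_mk x
    have hD := isReflexiveRankOne_inv M.isReflexiveRankOne
    have := hD.finite
    have := hD.reflexive
    rw [inv_mk, mk_mul_mk, ← mk_self]
    let e : R ≃ₗ[R] Module.Dual R (Module.Dual R M.carrier ⊗[R] M.carrier) :=
      LinearEquiv.ofBijective _ (algebraMap_end_bijective hD.rank_one) ≪≫ₗ
        TensorProduct.lift.equiv (.id R) (Module.Dual R M.carrier) M.carrier R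
    exact mk_eq_mk_iff.2 ⟨e.dualMap ≪≫ₗ LinearMap.ringLmapEquivSelf R R R⟩

end Group

end Cl

end DivisorClass

/-! Over a Noetherian normal domain the dual of a module depends only on what happens at primes of
height at most one: a map that is an isomorphism there induces a bijection on duals
(`dualMap_bijective_of_forall_height_le_one`). Let P be such a prime of B. As A is factorial at the
preimage of P, reflexive modules M, N of rank one are free near it (`exists_isTrivialization`), so M
⊗ N → (M ⊗ N)** is an isomorphism there and stays one near P after base change. Dualizing, M ⊗ N and
(M ⊗ N)** have the same reflexive base change; multiplicativity then follows formally, because base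
change distributes over ⊗ and factors may be replaced by their double duals under a dual.

A local isomorphism is encoded by two maps whose composites are multiplication by one scalar outside
the prime, a form that survives base change without localizing. The zero prime of B gives rank one
even when A → B is not injective. -/

namespace DivisorClass

/-! ### Divisibility and duals in codimension one -/

/-- In a Noetherian normal domain, a proper prime colon ideal `(s : x)` with `s ≠ 0` has height at
most one. -/
theorem height_le_one_of_mem_iff_dvd_mul {R : Type*} [CommRing R] [IsDomain R]
    [IsNoetherianRing R] [IsIntegrallyClosed R] {P : Ideal R} (hP : P.IsPrime) {s x : R}
    (hs : s ≠ 0) (h : ∀ b, b ∈ P ↔ s ∣ b * x) : P.height ≤ 1 := by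
  have hsP : s ∈ P := (h s).2 (Dvd.intro _ rfl)
  have hx : ¬ s ∣ x := fun hd => hP.ne_top ((Ideal.eq_top_iff_one P).2 ((h 1).2 (by simpa)))
  -- Otherwise x/s multiplies the finitely generated module P into itself, so it is integral, hence
  -- in R, contradicting `hx`.
  obtain ⟨t, ht, u, hu, hut⟩ : ∃ t ∈ P, ∃ u, u ∉ P ∧ t * x = s * u := by
    by_contra! hcon
    have hsK : algebraMap R (FractionRing R) s ≠ 0 := by simpa using hs
    have hint : IsIntegral R
        (algebraMap R (FractionRing R) x / algebraMap R (FractionRing R) s) := by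
      refine isIntegral_of_smul_mem_submodule (M := FractionRing R)
        (Submodule.map (Algebra.linearMap R (FractionRing R)) P) ?_ ((IsNoetherian.noetherian P).map _) _ ?_
      · refine (Submodule.ne_bot_iff _).2 ⟨algebraMap R (FractionRing R) s, ⟨s, hsP, rfl⟩, hsK⟩
      · rintro _ ⟨b, hb, rfl⟩
        obtain ⟨c, hc⟩ := (h b).1 hb
        refine ⟨c, by_contra fun hcP => hcon b hb c hcP hc, ?_⟩
        have := congrArg (algebraMap R (FractionRing R)) hc
        simp only [map_mul] at this
        simp only [Algebra.linearMap_apply, smul_eq_mul]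
        field_simp
        rw [mul_comm, ← this, mul_comm]
    obtain ⟨r, hr⟩ := IsIntegrallyClosed.isIntegral_iff.1 hint
    refine hx ⟨r, IsFractionRing.injective R (FractionRing R) ?_⟩
    rw [map_mul, hr, mul_div_cancel₀ _ hsK]
  -- Since u is invertible at P, the relation t x = s u makes t generate P locally. Thus P is
  -- minimal over (t), and Krull's theorem applies.
  refine Ideal.height_le_one_of_isPrincipal_of_mem_minimalPrimes (Ideal.span {t}) P
    ⟨⟨hP, by simpa [Ideal.span_le] using ht⟩, ?_⟩
  rintro Q ⟨hQ, htQ⟩ hQP z hz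
  obtain ⟨w, hw⟩ := (h z).1 hz
  have h1 : z * u = w * t := by
    refine mul_left_cancel₀ hs ?_
    linear_combination t * hw - z * hut
  have h2 : z * u ∈ Q := h1 ▸ Q.mul_mem_left w (htQ (Ideal.mem_span_singleton_self t))
  exact (hQ.mem_or_mem h2).resolve_right fun hh => hu (hQP hh)

/-- Divisibility in a Noetherian normal domain can be tested at the primes of height at most one. -/
theorem dvd_of_forall_height_le_one {R : Type*} [CommRing R] [IsDomain R]
    [IsNoetherianRing R] [IsIntegrallyClosed R] {s x : R} (hs : s ≠ 0)
    (h : ∀ P : PrimeSpectrum R, P.asIdeal.height ≤ 1 → ∃ b ∉ P.asIdeal, s ∣ b * x) : s ∣ x := by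
  by_contra hx
  have hx' : (Ideal.Quotient.mk (Ideal.span {s}) x) ≠ 0 := by
    rwa [Ne, Ideal.Quotient.eq_zero_iff_mem, Ideal.mem_span_singleton]
  -- The annihilator of x in R/(s) lies in an associated prime, which is a colon ideal (s : y), so
  -- the previous lemma bounds its height.
  obtain ⟨P, hP, hle⟩ := exists_le_isAssociatedPrime_of_isNoetherianRing R _ hx'
  obtain ⟨hprime, y, hy⟩ := isAssociatedPrime_iff.1 hP
  obtain ⟨y, rfl⟩ := Ideal.Quotient.mk_surjective y
  have key : ∀ b z : R, b ∈ (⊥ : Submodule R (R ⧸ Ideal.span {s})).colon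
      {Ideal.Quotient.mk (Ideal.span {s}) z} ↔ s ∣ b * z := fun b z => by
    rw [Submodule.mem_colon_singleton, Submodule.mem_bot, ← Ideal.mem_span_singleton,
      ← Ideal.Quotient.eq_zero_iff_mem, map_mul]
    rfl
  obtain ⟨b, hb, hbx⟩ := h ⟨P, hprime⟩
    (height_le_one_of_mem_iff_dvd_mul (P := P) hprime hs fun b => by rw [hy, key])
  exact hb (hle ((key b x).2 hbx))

/-- Quotients by s are unique in a domain, so pointwise choices are automatically linear. -/
theorem exists_smul_eq_of_forall_dvd {R M : Type*} [CommRing R] [IsDomain R] [AddCommGroup M]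
    [Module R M] {s : R} (hs : s ≠ 0) {ψ : Module.Dual R M} (h : ∀ m, s ∣ ψ m) :
    ∃ χ : Module.Dual R M, s • χ = ψ := by
  choose q hq using h
  refine ⟨⟨⟨q, fun y z => mul_left_cancel₀ hs ?_⟩, fun r y => mul_left_cancel₀ hs ?_⟩, ?_⟩
  · rw [mul_add, ← hq, ← hq, ← hq, map_add]
  · rw [← hq, map_smul, hq, RingHom.id_apply, smul_eq_mul, smul_eq_mul]
    ring
  · ext m
    exact (hq m).symm

/-- A homomorphism of modules over a Noetherian normal domain that is invertible near every prime
of height at most one induces a bijection on duals. -/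
theorem dualMap_bijective_of_forall_height_le_one {R : Type*} [CommRing R] [IsDomain R]
    [IsNoetherianRing R] [IsIntegrallyClosed R] {X Y : Type*} [AddCommGroup X] [Module R X]
    [AddCommGroup Y] [Module R Y] (f : X →ₗ[R] Y)
    (h : ∀ P : PrimeSpectrum R, P.asIdeal.height ≤ 1 → ∃ t ∉ P.asIdeal, ∃ g : Y →ₗ[R] X,
      (∀ x, g (f x) = t • x) ∧ ∀ y, f (g y) = t • y) :
    Function.Bijective f.dualMap := by
  obtain ⟨s, hs, g, hgf, hfg⟩ := h ⊥ (by simp [PrimeSpectrum.asIdeal_bot])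
  have hs : s ≠ 0 := by simpa [PrimeSpectrum.asIdeal_bot] using hs
  have hinj : Function.Injective f.dualMap := by
    rw [injective_iff_map_eq_zero]
    intro ψ hψ
    ext y
    have h1 : ψ (f (g y)) = 0 := LinearMap.congr_fun hψ (g y)
    rw [hfg, map_smul, smul_eq_mul] at h1
    simpa [hs] using h1
  refine ⟨hinj, fun ψ => ?_⟩
  -- The extension of ψ to Y should be (ψ ∘ g)/s, with g the generic inverse. Comparing g with the
  -- inverse k near P shows that s divides t · ψ(g y).
  have hdvd : ∀ y, s ∣ (ψ ∘ₗ g) y := fun y => by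
    refine dvd_of_forall_height_le_one hs fun P hP => ?_
    obtain ⟨t, ht, k, hkf, -⟩ := h P hP
    refine ⟨t, ht, ψ (k y), ?_⟩
    have h1 : s • (ψ ∘ₗ k) = t • (ψ ∘ₗ g) := hinj (by
      ext x
      simp only [LinearMap.dualMap_apply, LinearMap.smul_apply, LinearMap.comp_apply, hkf, hgf,
        map_smul]
      rw [smul_comm])
    exact (LinearMap.congr_fun h1 y).symm
  obtain ⟨χ, hχ⟩ := exists_smul_eq_of_forall_dvd hs hdvd
  refine ⟨χ, LinearMap.ext fun x => mul_left_cancel₀ hs ?_⟩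
  have h1 := LinearMap.congr_fun hχ (f x)
  simp only [LinearMap.smul_apply, smul_eq_mul, LinearMap.comp_apply, hgf, map_smul] at h1
  exact h1

/-! ### Isomorphisms up to a scalar and trivializations -/

theorem baseChange_apply_of_comp_eq_smul {R S X Y : Type*} [CommRing R] [CommRing S] [Algebra R S]
    [AddCommGroup X] [Module R X] [AddCommGroup Y] [Module R Y] {f : X →ₗ[R] Y} {g : Y →ₗ[R] X}
    {t : R} (h : ∀ x, g (f x) = t • x) (x : S ⊗[R] X) :
    g.baseChange S (f.baseChange S x) = algebraMap R S t • x := by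
  induction x with
  | zero => simp
  | add x y hx hy => simp only [map_add, hx, hy, smul_add]
  | tmul k x => simp [h, TensorProduct.tmul_smul]

/-- Over a domain, modules that are isomorphic up to a nonzero scalar have equal rank. -/
theorem finrank_eq_of_comp_eq_smul {R : Type*} [CommRing R] [IsDomain R]
    {X Y : Type*} [AddCommGroup X] [Module R X]
    [AddCommGroup Y] [Module R Y] (f : X →ₗ[R] Y) (g : Y →ₗ[R] X) {t : R} (ht : t ≠ 0)
    (hgf : ∀ x, g (f x) = t • x) (hfg : ∀ y, f (g y) = t • y) :
    Module.finrank R X = Module.finrank R Y := by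
  let K := FractionRing R
  have htK : IsUnit (algebraMap R K t) := IsUnit.mk0 _ (by simpa using ht)
  have h1 := baseChange_apply_of_comp_eq_smul (S := K) hgf
  have h2 := baseChange_apply_of_comp_eq_smul (S := K) hfg
  have hbij : Function.Bijective (f.baseChange K) := by
    refine ⟨fun x y hxy => htK.smul_left_cancel.1 ?_, fun y => ?_⟩
    · rw [← h1, ← h1, hxy]
    · obtain ⟨y, rfl⟩ : ∃ z, algebraMap R K t • z = y := htK.smul_bijective.2 y
      exact ⟨_, h2 y⟩
  rw [← finrank_fractionRing_tensor (M := X), ← finrank_fractionRing_tensor (M := Y)]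
  exact (LinearEquiv.ofBijective _ hbij).finrank_eq

/-- `M` becomes free of rank one, with generator `m₀` and coordinate `α`, after inverting `t`. -/
structure IsTrivialization {R M : Type*} [CommRing R] [AddCommGroup M] [Module R M]
    (α : Module.Dual R M) (m₀ : M) (t : R) : Prop where
  apply_gen : α m₀ = t
  apply_smul_gen : ∀ m, α m • m₀ = t • m

namespace IsTrivialization

variable {R M N : Type*} [CommRing R] [AddCommGroup M] [Module R M] [AddCommGroup N] [Module R N]

theorem tensor {α : Module.Dual R M} {m₀ : M} {t : R} (hM : IsTrivialization α m₀ t)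
    {β : Module.Dual R N} {n₀ : N} {s : R} (hN : IsTrivialization β n₀ s) :
    IsTrivialization (LinearMap.mul' R R ∘ₗ TensorProduct.map α β) (m₀ ⊗ₜ[R] n₀) (t * s) where
  apply_gen := by simp [hM.apply_gen, hN.apply_gen]
  apply_smul_gen x := by
    induction x with
    | zero => simp
    | add x y hx hy => simp only [map_add, add_smul, smul_add, hx, hy]
    | tmul m n =>
      rw [LinearMap.comp_apply, TensorProduct.map_tmul, LinearMap.mul'_apply,
        ← TensorProduct.smul_tmul_smul, hM.apply_smul_gen, hN.apply_smul_gen,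
        TensorProduct.smul_tmul_smul]

/-- The inverse of evaluation up to t is ξ ↦ ξ(α) m₀; M itself need not be reflexive. -/
theorem evalInv_eval {α : Module.Dual R M} {m₀ : M} {t : R} (h : IsTrivialization α m₀ t)
    (m : M) :
    (LinearMap.toSpanSingleton R M m₀ ∘ₗ Module.Dual.eval R (Module.Dual R M) α)
      (Module.Dual.eval R M m) = t • m := by
  simp [h.apply_smul_gen]

theorem eval_evalInv {α : Module.Dual R M} {m₀ : M} {t : R} (h : IsTrivialization α m₀ t)
    (ξ : DoubleDual R M) :
    Module.Dual.eval R M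
      ((LinearMap.toSpanSingleton R M m₀ ∘ₗ Module.Dual.eval R (Module.Dual R M) α) ξ) =
      t • ξ := by
  ext ψ
  -- After inverting t, α generates the dual, so ξ is determined by ξ(α).
  have h1 : ψ m₀ • α = t • ψ := by
    ext m
    have := congrArg ψ (h.apply_smul_gen m)
    simp only [map_smul, smul_eq_mul] at this
    simp only [LinearMap.smul_apply, smul_eq_mul, ← this, mul_comm]
  have h2 := congrArg ξ h1
  simp only [map_smul, smul_eq_mul] at h2
  simp [← h2, mul_comm]

end IsTrivialization

/-! ### Local freeness at factorial primes -/

/-- Homomorphisms from a module of rank one to the base domain are proportional. -/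
theorem dual_apply_mul_apply_comm {R M : Type*} [CommRing R] [IsDomain R] [AddCommGroup M]
    [Module R M] [Module.Finite R M] (h : Module.finrank R M = 1) (α ψ : Module.Dual R M)
    (m n : M) : α m * ψ n = ψ m * α n := by
  have hdep : ¬ LinearIndependent R ![m, n] := fun hli => by
    have := hli.fintype_card_le_finrank
    simp [h] at this
  rw [LinearIndependent.pair_iff] at hdep
  push Not at hdep
  obtain ⟨a, b, hab, hne⟩ := hdep
  have h1 := congrArg α hab
  have h2 := congrArg ψ hab
  simp only [map_add, map_smul, smul_eq_mul, map_zero] at h1 h2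
  by_cases ha : a = 0
  · refine mul_left_cancel₀ (hne ha) ?_
    linear_combination α m * h2 - ψ m * h1
  · refine mul_left_cancel₀ ha ?_
    linear_combination ψ n * h1 - α n * h2

/-- In a unique factorization domain, the greatest common divisor of a finite family can be split
off, leaving a family for which divisibility can be tested termwise. -/
theorem exists_eq_mul_and_dvd_of_forall_dvd_mul {S ι : Type*} [CommRing S] [IsDomain S]
    [UniqueFactorizationMonoid S] (s : Finset ι) (hs : s.Nonempty) (a : ι → S) :
    ∃ (d : S) (c : ι → S), (∀ i ∈ s, a i = d * c i) ∧
      ∀ x y : S, (∀ i ∈ s, y ∣ x * c i) → y ∣ x := by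
  classical
  let := UniqueFactorizationMonoid.strongNormalizationMonoid (α := S)
  let := UniqueFactorizationMonoid.toNormalizedGCDMonoid S
  obtain ⟨c, hc, h1⟩ := s.extract_gcd a hs
  refine ⟨s.gcd a, c, hc, fun x y h => ?_⟩
  have h2 := (Finset.dvd_gcd h).trans (s.gcd_mul_left' (f := c) x).dvd
  rwa [h1, mul_one] at h2

/-- A reflexive module of rank one is free near every prime at which the base is factorial. -/
theorem exists_isTrivialization {R M : Type*} [CommRing R] [IsDomain R] [IsNoetherianRing R]
    [AddCommGroup M] [Module R M] (hM : IsReflexiveRankOne R M) {p : PrimeSpectrum R}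
    (hp : p ∈ UFDLocus R) :
    ∃ t ∉ p.asIdeal, ∃ (α : Module.Dual R M) (m₀ : M), IsTrivialization α m₀ t := by
  have := hM.finite
  have := hM.reflexive
  have := finite_dual (R := R) (M := M)
  let S := Localization.AtPrime p.asIdeal
  have : UniqueFactorizationMonoid S := hp
  have : IsDomain S := IsLocalization.isDomain_localization p.asIdeal.primeCompl_le_nonZeroDivisors
  have hinj : Function.Injective (algebraMap R S) :=
    IsLocalization.injective S p.asIdeal.primeCompl_le_nonZeroDivisors
  have : Nontrivial (Module.Dual R M) :=
    Module.nontrivial_of_finrank_pos (R := R) (by rw [finrank_dual, hM.rank_one]; exact one_pos)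
  obtain ⟨α₀, hα₀⟩ := exists_ne (0 : Module.Dual R M)
  obtain ⟨G, hG⟩ := Module.Finite.fg_top (R := R) (M := M)
  have hext : ∀ ψ χ : Module.Dual R M, (∀ m ∈ G, ψ m = χ m) → ψ = χ := fun ψ χ h =>
    LinearMap.ext_on hG h
  have hGne : G.Nonempty := by
    by_contra hne
    rw [Finset.not_nonempty_iff_eq_empty] at hne
    exact hα₀ (hext _ _ (by simp [hne]))
  -- A functional whose values on generators have no common factor should generate the dual near p;
  -- hence the gcd of the values of `α₀` is removed.
  obtain ⟨d, c, hc, hdvd⟩ := exists_eq_mul_and_dvd_of_forall_dvd_mul G hGne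
    fun m => algebraMap R S (α₀ m)
  have hd : d ≠ 0 := by
    rintro rfl
    refine hα₀ (hext _ _ fun m hm => hinj ?_)
    rw [hc m hm]
    simp
  -- dividing `α₀` by `d` and clearing denominators
  obtain ⟨α, e, he, hα⟩ : ∃ (α : Module.Dual R M) (e : S), IsUnit e ∧
      ∀ m ∈ G, algebraMap R S (α m) = e * c m := by
    obtain ⟨u, hu⟩ := IsLocalization.exist_integer_multiples p.asIdeal.primeCompl G c
    obtain ⟨⟨d₀, s⟩, hds⟩ := IsLocalization.surj p.asIdeal.primeCompl d
    simp only at hds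
    have hsu : IsUnit (algebraMap R S s) := IsLocalization.map_units S s
    have hd₀ : d₀ ≠ 0 := by
      rintro rfl
      rw [map_zero] at hds
      exact (mul_ne_zero hd hsu.ne_zero) hds
    have hall : ∀ m, d₀ ∣ ((s * u : R) • α₀) m := fun m => by
      have hm : m ∈ Submodule.span R (G : Set M) := hG ▸ Submodule.mem_top
      induction hm using Submodule.span_induction with
      | zero => simp
      | add x y _ _ hx hy => rw [map_add]; exact dvd_add hx hy
      | smul r x _ hx => rw [map_smul]; exact hx.mul_left r
      | mem x hx =>
        obtain ⟨r, hr⟩ := hu x hx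
        refine ⟨r, hinj ?_⟩
        rw [LinearMap.smul_apply, smul_eq_mul, map_mul, map_mul, map_mul, hr, ← hds, hc x hx,
          Algebra.smul_def]
        ring
    obtain ⟨α, hα⟩ := exists_smul_eq_of_forall_dvd hd₀ hall
    refine ⟨α, algebraMap R S u, IsLocalization.map_units S u, fun m hm => ?_⟩
    have h1 := congrArg (algebraMap R S) (LinearMap.congr_fun hα m)
    simp only [LinearMap.smul_apply, smul_eq_mul, map_mul, ← hds, hc m hm] at h1
    refine mul_left_cancel₀ (mul_ne_zero hd hsu.ne_zero) ?_
    linear_combination h1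
  obtain ⟨m₁, hm₁, hm₁0⟩ : ∃ m ∈ G, c m ≠ 0 := by
    by_contra! hcon
    exact hα₀ (hext _ _ fun m hm => hinj (by rw [hc m hm, hcon m hm]; simp))
  -- By rank one, ψ is a fraction times α. Its denominator divides out in S because the `c m` have
  -- no common factor.
  have hdiv : ∀ ψ : Module.Dual R M, ∃ t ∉ p.asIdeal, ∃ a : R, t • ψ = a • α := fun ψ => by
    have h1 : ∀ m ∈ G, c m₁ * algebraMap R S (ψ m) = algebraMap R S (ψ m₁) * c m := fun m hm => by
      refine he.mul_left_cancel ?_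
      rw [← mul_assoc, ← hα m₁ hm₁, mul_left_comm, ← hα m hm, ← map_mul, ← map_mul,
        dual_apply_mul_apply_comm hM.rank_one]
    obtain ⟨q, hq⟩ := hdvd (algebraMap R S (ψ m₁)) (c m₁) fun m hm => ⟨_, (h1 m hm).symm⟩
    obtain ⟨e', he'⟩ := he.exists_left_inv
    obtain ⟨⟨a, t⟩, hat⟩ := IsLocalization.surj p.asIdeal.primeCompl (q * e')
    refine ⟨t, t.2, a, hext _ _ fun m hm => hinj ?_⟩
    simp only at hat
    have h2 : algebraMap R S (ψ m) = q * c m := by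
      refine mul_left_cancel₀ hm₁0 ?_
      rw [h1 m hm, hq, mul_assoc]
    simp only [LinearMap.smul_apply, smul_eq_mul, map_mul, h2, hα m hm, ← hat]
    linear_combination (- (algebraMap R S t) * q * c m) * he'
  -- The dual is finitely generated, so a product of denominators over generators serves every ψ.
  obtain ⟨t, ht, hta⟩ : ∃ t ∉ p.asIdeal, ∀ ψ : Module.Dual R M, ∃ a : R, t • ψ = a • α := by
    obtain ⟨H, hH⟩ := Module.Finite.fg_top (R := R) (M := Module.Dual R M)
    choose τ hτ a ha using hdiv
    refine ⟨∏ ψ ∈ H, τ ψ, fun hmem => ?_, fun ψ => ?_⟩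
    · obtain ⟨ψ, -, hψ⟩ := (p.isPrime.prod_mem_iff).1 hmem
      exact hτ ψ hψ
    · have hψ : ψ ∈ Submodule.span R (H : Set (Module.Dual R M)) := hH ▸ Submodule.mem_top
      induction hψ using Submodule.span_induction with
      | zero => exact ⟨0, by simp⟩
      | add x y _ _ hx hy =>
        obtain ⟨b, hb⟩ := hx
        obtain ⟨b', hb'⟩ := hy
        exact ⟨b + b', by rw [smul_add, hb, hb', add_smul]⟩
      | smul r x _ hx =>
        obtain ⟨b, hb⟩ := hx
        exact ⟨r * b, by rw [smul_comm, hb, mul_smul]⟩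
      | mem x hx =>
        obtain ⟨w, hw⟩ := Finset.dvd_prod_of_mem τ hx
        exact ⟨w * a x, by rw [hw, mul_comm, mul_smul, ha, mul_smul]⟩
  have hα0 : α m₁ ≠ 0 := fun h0 => by
    have h1 := hα m₁ hm₁
    rw [h0, map_zero] at h1
    exact mul_ne_zero he.ne_zero hm₁0 h1.symm
  -- Here ξ sends ψ to the coefficient a in t ψ = a α; reflexivity realizes ξ as evaluation at the
  -- generator `m₀`.
  obtain ⟨ξ, hξ⟩ := exists_smul_eq_of_forall_dvd (ψ := t • Module.Dual.eval R M m₁) hα0 fun ψ => by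
    obtain ⟨a, ha⟩ := hta ψ
    exact ⟨a, (LinearMap.congr_fun ha m₁).trans (mul_comm _ _)⟩
  obtain ⟨m₀, rfl⟩ := (Module.bijective_dual_eval R M).2 ξ
  have hm₀ : ∀ ψ : Module.Dual R M, α m₁ * ψ m₀ = t * ψ m₁ := LinearMap.congr_fun hξ
  refine ⟨t, ht, α, m₀, mul_left_cancel₀ hα0 ((hm₀ α).trans (mul_comm _ _)), fun m => ?_⟩
  refine (Module.bijective_dual_eval R M).1 (LinearMap.ext fun ψ => mul_left_cancel₀ hα0 ?_)
  simp only [map_smul, LinearMap.smul_apply, Module.Dual.eval_apply, smul_eq_mul]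
  linear_combination α m * hm₀ ψ + t * dual_apply_mul_apply_comm hM.rank_one α ψ m m₁

/-! ### Reflexive base change and the induced homomorphism -/

section BaseChange

variable {A : Type u} {B : Type v} [CommRing A] [IsDomain A] [IsNoetherianRing A]
  [CommRing B] [IsDomain B] [IsNoetherianRing B] [Algebra A B]

/-- The prime in question is the kernel of A → B, so t has nonzero image and α identifies B ⊗ M with
B up to that scalar. -/
theorem isReflexiveRankOne_baseChange
    (h : PrimeSpectrum.comap (algebraMap A B) ⊥ ∈ UFDLocus A)
    {M : Type w} [AddCommGroup M] [Module A M] (hM : IsReflexiveRankOne A M) :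
    IsReflexiveRankOne B (DoubleDual B (B ⊗[A] M)) := by
  have := hM.finite
  obtain ⟨t, ht, α, m₀, htriv⟩ := exists_isTrivialization hM h
  refine isReflexiveRankOne_doubleDual ?_
  have h1 := finrank_eq_of_comp_eq_smul (LinearMap.baseChange B α)
    ((LinearMap.toSpanSingleton A M m₀).baseChange B) (t := algebraMap A B t)
    (by simpa [PrimeSpectrum.asIdeal_bot] using ht)
    (baseChange_apply_of_comp_eq_smul fun m => by simp [htriv.apply_smul_gen])
    (baseChange_apply_of_comp_eq_smul fun a => by simp [htriv.apply_gen, mul_comm])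
  rw [h1, (AlgebraTensorModule.rid A B B).finrank_eq, Module.finrank_self]

variable [IsIntegrallyClosed B]

/-- Reflexive base change along `A → B` is compatible with products of classes. -/
theorem baseChange_doubleDual_tensor
    (hUFD : ∀ P : PrimeSpectrum B, P.asIdeal.height ≤ 1 →
      PrimeSpectrum.comap (algebraMap A B) P ∈ UFDLocus A)
    {M : Type*} [AddCommGroup M] [Module A M] (hM : IsReflexiveRankOne A M)
    {N : Type*} [AddCommGroup N] [Module A N] (hN : IsReflexiveRankOne A N) :
    Nonempty (Module.Dual B (B ⊗[A] DoubleDual A (M ⊗[A] N)) ≃ₗ[B]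
      Module.Dual B (DoubleDual B (B ⊗[A] M) ⊗[B] DoubleDual B (B ⊗[A] N))) := by
  have := hM.finite
  have := hN.finite
  have hbij : Function.Bijective ((Module.Dual.eval A (M ⊗[A] N)).baseChange B).dualMap := by
    refine dualMap_bijective_of_forall_height_le_one _ fun P hP => ?_
    obtain ⟨t, ht, α, m₀, hα⟩ := exists_isTrivialization hM (hUFD P hP)
    obtain ⟨s, hs, β, n₀, hβ⟩ := exists_isTrivialization hN (hUFD P hP)
    have hts : t * s ∉ (PrimeSpectrum.comap (algebraMap A B) P).asIdeal := fun hmem =>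
      ((PrimeSpectrum.comap (algebraMap A B) P).isPrime.mem_or_mem hmem).elim ht hs
    exact ⟨algebraMap A B (t * s), hts, _,
      baseChange_apply_of_comp_eq_smul (hα.tensor hβ).evalInv_eval,
      baseChange_apply_of_comp_eq_smul (hα.tensor hβ).eval_evalInv⟩
  -- The swaps bring each factor in turn to the left, where `dualDoubleDualTensor` inserts its
  -- double dual.
  exact ⟨LinearEquiv.ofBijective _ hbij ≪≫ₗ
    (AlgebraTensorModule.distribBaseChange A B M N).symm.dualMap ≪≫ₗ
    (TensorProduct.comm B (B ⊗[A] N) (B ⊗[A] M)).dualMap ≪≫ₗ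
    dualDoubleDualTensor.symm ≪≫ₗ
    (TensorProduct.comm B (B ⊗[A] M) (DoubleDual B (B ⊗[A] N))).dualMap ≪≫ₗ
    dualDoubleDualTensor.symm⟩

variable [IsIntegrallyClosed A]

/-- The homomorphism of divisor class groups induced by reflexive base change. -/
noncomputable def Cl.map
    (hUFD : ∀ P : PrimeSpectrum B, P.asIdeal.height ≤ 1 →
      PrimeSpectrum.comap (algebraMap A B) P ∈ UFDLocus A) : Cl A →* Cl B :=
  have h₀ := hUFD ⊥ (by simp [PrimeSpectrum.asIdeal_bot])
  MonoidHom.mk'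
    (Quotient.lift
      (fun M : RankOneReflexive A =>
        Cl.mk B _ (isReflexiveRankOne_baseChange h₀ M.isReflexiveRankOne))
      fun _ _ ⟨e⟩ => Cl.mk_eq_mk_iff.2 ⟨(e.baseChange A B _ _).dualMap.dualMap⟩)
    fun x y => by
      induction x using Quotient.inductionOn with | h M => ?_
      induction y using Quotient.inductionOn with | h N => ?_
      refine Eq.trans ?_ (Cl.mk_mul_mk _ _).symm
      refine Cl.mk_eq_mk_iff.2 ?_
      obtain ⟨e⟩ := baseChange_doubleDual_tensor hUFD M.isReflexiveRankOne N.isReflexiveRankOne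
      exact ⟨e.symm.dualMap⟩

theorem Cl.map_mk
    (hUFD : ∀ P : PrimeSpectrum B, P.asIdeal.height ≤ 1 →
      PrimeSpectrum.comap (algebraMap A B) P ∈ UFDLocus A)
    {M : Type u} [AddCommGroup M] [Module A M] (hM : IsReflexiveRankOne A M)
    (hN : IsReflexiveRankOne B (DoubleDual B (B ⊗[A] M))) :
    Cl.map hUFD (Cl.mk A M hM) = Cl.mk B (DoubleDual B (B ⊗[A] M)) hN := by
  rw [Cl.mk_carrier ⟨M, hM⟩]
  rfl

end BaseChange

end DivisorClass

theorem mainTheorem3 {A : Type u} {B : Type v}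
    [CommRing A] [IsDomain A] [IsNoetherianRing A] [IsIntegrallyClosed A]
    [CommRing B] [IsDomain B] [IsNoetherianRing B] [IsIntegrallyClosed B]
    [Algebra A B]
    (hUFD : ∀ P : PrimeSpectrum B, P.asIdeal.height ≤ 1 →
      PrimeSpectrum.comap (algebraMap A B) P ∈ DivisorClass.UFDLocus A) :
    ∃! f : DivisorClass.Cl A →* DivisorClass.Cl B,
      ∀ (M : Type u) [AddCommGroup M] [Module A M] (hM : DivisorClass.IsReflexiveRankOne A M),
        ∃ hN : DivisorClass.IsReflexiveRankOne B (DivisorClass.DoubleDual B (B ⊗[A] M)),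
          f (DivisorClass.Cl.mk A M hM) =
            DivisorClass.Cl.mk B (DivisorClass.DoubleDual B (B ⊗[A] M)) hN := by
  have h₀ := hUFD ⊥ (by simp [PrimeSpectrum.asIdeal_bot])
  refine ⟨DivisorClass.Cl.map hUFD, fun M _ _ hM =>
    ⟨DivisorClass.isReflexiveRankOne_baseChange h₀ hM, DivisorClass.Cl.map_mk hUFD hM _⟩,
    fun f hf => MonoidHom.ext fun x => ?_⟩
  obtain ⟨M, rfl⟩ := DivisorClass.Cl.exists_eq_mk x
  obtain ⟨hN, hfM⟩ := hf M.carrier M.isReflexiveRankOne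
  rw [hfM, DivisorClass.Cl.map_mk hUFD M.isReflexiveRankOne hN]
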